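/- Let $K_{m,n}$ be the complete bipartite graph with classes $M$, $N$ of sizes $m$ and $n$. A path in an edge-coloured graph is \emph{alternating} if any two adjacent edges of it have different colours. For $r,k\ge 1$ let $\kappa_{r,2k}(m,n)$ be the maximum $t$ for which there is an $r$-colouring of the edges of $K_{m,n}$ such that any two distinct vertices of $N$ (the class of size $n$) are connected by $t$ internally disjoint alternating paths of length $2k$ (that is, with $2k$ edges). Let $r\ge 2$ and $k\ge 2$ be fixed integers, and let $m=m(n)$ be a sequence of positive integers with $m(n)\le n$ and $m(n)\to\infty$ as $n\to\infty$. Then \[ \kappa_{r,2k}(m,n)\sim \frac{m}{k}\qquad (n\to\infty). \] Moreover, two colours already suffice: there are integers $t(n)\ge 0$ with $t(n)\sim m/k$ such that, for all sufficiently large $n$, some $r$-colouring of the edges of $K_{m,n}$ using at most two of the $r$ colours connects any two distinct vertices of $N$ by $t(n)$ internally disjoint alternating paths of length $2k$. -/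

import Mathlib

open Filter Asymptotics

namespace AltPaths

variable {V K : Type*} {G : SimpleGraph V}

/-- A walk in an edge-coloured graph is alternating if any two consecutive edges of it have
different colours. -/
def IsAlternating (c : G.EdgeLabeling K) {u v : V} (p : G.Walk u v) : Prop :=
  p.darts.IsChain fun d e => c ⟨d.edge, d.edge_mem⟩ ≠ c ⟨e.edge, e.edge_mem⟩

/-- `u` and `v` are connected by `t` (distinct) internally disjoint alternating paths, each with
exactly `ℓ` edges. -/
def JoinedBy (c : G.EdgeLabeling K) (ℓ t : ℕ) (u v : V) : Prop :=
  ∃ P : Fin t → G.Walk u v,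
    Function.Injective P ∧
    (∀ i, (P i).IsPath ∧ (P i).length = ℓ ∧ IsAlternating c (P i)) ∧
    ∀ i j, i ≠ j → ∀ x, x ∈ (P i).support → x ∈ (P j).support → x = u ∨ x = v

/-- The complete bipartite graph `K_{m,n}`; its classes are the left copy of `Fin m` and the right
copy of `Fin n`. -/
abbrev Kmn (m n : ℕ) : SimpleGraph (Fin m ⊕ Fin n) :=
  completeBipartiteGraph (Fin m) (Fin n)

/-- Under the colouring `c` of `K_{m,n}`, any two distinct vertices of the class of size `n` are
connected by `t` internally disjoint alternating paths of length `ℓ`. -/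
def Connects {m n : ℕ} (c : (Kmn m n).EdgeLabeling K) (ℓ t : ℕ) : Prop :=
  ∀ u v : Fin n, u ≠ v → JoinedBy c ℓ t (Sum.inr u) (Sum.inr v)

/-- `κ_{r,ℓ}(m,n)`: the maximum `t` such that some colouring of the edges of `K_{m,n}` with colours
`Fin r` connects any two vertices of the class of size `n` by `t` internally disjoint alternating
paths of length `ℓ`. It is a genuine maximum as soon as `2 ≤ n`, `1 ≤ r` and `2 ≤ ℓ`, see
`isGreatest_kappa`. -/
noncomputable def kappa (r ℓ m n : ℕ) : ℕ :=
  sSup {t : ℕ | ∃ c : (Kmn m n).EdgeLabeling (Fin r), Connects c ℓ t}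

theorem isGreatest_kappa {r ℓ m n : ℕ} (hr : 1 ≤ r) (hℓ : 2 ≤ ℓ) (hn : 2 ≤ n) :
    IsGreatest {t : ℕ | ∃ c : (Kmn m n).EdgeLabeling (Fin r), Connects c ℓ t}
      (kappa r ℓ m n) := by
  have hb : BddAbove {t : ℕ | ∃ c : (Kmn m n).EdgeLabeling (Fin r), Connects c ℓ t} := by
    refine ⟨Fintype.card (Fin m ⊕ Fin n), ?_⟩
    rintro t ⟨c, hc⟩
    obtain ⟨P, -, hP, hd⟩ := hc ⟨0, by omega⟩ ⟨1, by omega⟩ (by simp)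
    have hinj : Function.Injective fun i => (P i).getVert 1 := by
      intro i j hij
      by_contra hne
      have h1 := hd i j hne ((P i).getVert 1) ((P i).getVert_mem_support 1)
        (by simp only at hij; rw [hij]; exact (P j).getVert_mem_support 1)
      obtain ⟨hp, hl, -⟩ := hP i
      have hi := hp.getVert_injOn
      rcases h1 with h | h
      · have := hi (x₁ := 1) (x₂ := 0) (by simp; omega) (by simp) (by simpa using h)
        omega
      · have := hi (x₁ := 1) (x₂ := (P i).length) (by simp; omega) (by simp) (by simpa using h)
        omega
    simpa using Fintype.card_le_of_injective _ hinj
  refine ⟨Nat.sSup_mem ⟨0, fun _ => ⟨0, hr⟩, ?_⟩ hb, fun t ht => le_csSup hb ht⟩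
  intro u v _
  exact ⟨fun i => i.elim0, fun i => i.elim0, fun i => i.elim0, fun i => i.elim0⟩

end AltPaths

/-! Upper bound: a path of length `2k` between vertices of `N` has `k` vertices in `M`, and these
differ for disjoint paths, so `k * t ≤ m` for every colouring (`mul_le_of_connects`).

Lower bound: colour by a 0-1 matrix with balanced columns and no constant `s × s` submatrix in its
first `m` columns, `s = O(√m)`. Given `u ≠ v` and a first colour `b`, split the vertices into levels
of about `m / (2k)` vertices: `k` row levels alternating with `k - 1` column levels. The row levels
consist of neighbours of `u` in colour `b`, except the last, which consists of neighbours of `v` in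
the opposite colour. As any `s` vertices of a level send an edge of the prescribed colour to any `s`
of the next, greedy matchings lose at most `s` paths per step. The two values of `b` together give
`m / k - O(√m)` paths (`connects_matrixColoring`).

The matrix consists of odd columns of a Sylvester–Hadamard matrix: orthogonality excludes large
constant submatrices, and each odd column takes opposite signs on rows `2i` and `2i + 1`. -/

namespace AltPaths

/-! ### Sylvester–Hadamard matrices and their constant submatrices -/

/-- The entries `±1` of the Sylvester–Hadamard matrix of order `2 ^ q`. -/
def sylvester : ℕ → ℕ → ℕ → ℤ
  | 0, _, _ => 1
  | q + 1, a, x => (if a % 2 = 1 ∧ x % 2 = 1 then -1 else 1) * sylvester q (a / 2) (x / 2)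

theorem sylvester_eq_or (q a x : ℕ) : sylvester q a x = 1 ∨ sylvester q a x = -1 := by
  induction q generalizing a x with
  | zero => simp [sylvester]
  | succ q ih =>
    rw [sylvester]
    rcases ih (a / 2) (x / 2) with h | h <;> rw [h] <;> split_ifs <;> simp

theorem sum_range_two_mul (f : ℕ → ℤ) (N : ℕ) :
    ∑ x ∈ Finset.range (2 * N), f x = ∑ y ∈ Finset.range N, (f (2 * y) + f (2 * y + 1)) := by
  induction N with
  | zero => simp
  | succ N ih =>
    rw [show 2 * (N + 1) = 2 * N + 1 + 1 by ring, Finset.sum_range_succ, Finset.sum_range_succ, ih,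
      Finset.sum_range_succ]
    ring

/-- Induction on the number of binary digits: the columns `2y` and `2y + 1` cancel if the last
digits of `a` and `b` differ, and otherwise double the product of order `2 ^ q`. -/
theorem sum_sylvester_mul (q a b : ℕ) (ha : a < 2 ^ q) (hb : b < 2 ^ q) :
    ∑ x ∈ Finset.range (2 ^ q), sylvester q a x * sylvester q b x =
      if a = b then 2 ^ q else 0 := by
  induction q generalizing a b with
  | zero =>
    have : a = b := by simp at ha hb; omega
    simp [sylvester, this]
  | succ q ih =>
    have ih' := ih (a / 2) (b / 2) (by rw [pow_succ] at ha; omega) (by rw [pow_succ] at hb; omega)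
    have key : ∀ y, sylvester (q + 1) a (2 * y) * sylvester (q + 1) b (2 * y) +
        sylvester (q + 1) a (2 * y + 1) * sylvester (q + 1) b (2 * y + 1) =
        (if a % 2 = b % 2 then 2 else 0) *
          (sylvester q (a / 2) y * sylvester q (b / 2) y) := by
      intro y
      have h1 : (2 * y) / 2 = y := by omega
      have h2 : (2 * y + 1) / 2 = y := by omega
      have h3 : (2 * y) % 2 = 0 := by omega
      have h4 : (2 * y + 1) % 2 = 1 := by omega
      simp only [sylvester, h1, h2, h3, h4]
      rcases Nat.mod_two_eq_zero_or_one a with h | h <;>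
        rcases Nat.mod_two_eq_zero_or_one b with h' | h' <;> simp [h, h'] <;> ring
    rw [pow_succ, mul_comm, sum_range_two_mul]
    simp only [key]
    rw [← Finset.mul_sum, ih']
    by_cases hab : a = b
    · simp [hab]
      ring
    · rw [if_neg hab]
      by_cases h : a % 2 = b % 2
      · rw [if_neg (show ¬ a / 2 = b / 2 by omega), mul_zero]
      · rw [if_neg h, zero_mul]

/-- A constant submatrix of the Sylvester–Hadamard matrix of order `N` has at most `N` entries. -/
theorem card_mul_card_le_of_sylvester_eq {q : ℕ} {A X : Finset ℕ} (hA : A ⊆ Finset.range (2 ^ q))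
    (hX : X ⊆ Finset.range (2 ^ q)) {ε : ℤ} (hε : ε ^ 2 = 1)
    (h : ∀ a ∈ A, ∀ x ∈ X, sylvester q a x = ε) : A.card * X.card ≤ 2 ^ q := by
  rcases A.eq_empty_or_nonempty with rfl | hne
  · simp
  have h1 : ∑ x ∈ X, (∑ a ∈ A, sylvester q a x) ^ 2 = (X.card : ℤ) * (A.card : ℤ) ^ 2 := by
    rw [Finset.sum_congr rfl (g := fun _ => (A.card : ℤ) ^ 2)]
    · simp
    · intro x hx
      rw [Finset.sum_congr rfl fun a ha => h a ha x hx]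
      simp [mul_pow, hε]
  -- By orthogonality only the diagonal terms of the expanded square survive; the columns in `X`
  -- alone contribute `|X| |A| ^ 2`.
  have h2 : ∑ x ∈ Finset.range (2 ^ q), (∑ a ∈ A, sylvester q a x) ^ 2 =
      (A.card : ℤ) * 2 ^ q := by
    simp only [sq, Finset.sum_mul_sum]
    rw [Finset.sum_comm, Finset.sum_congr rfl (g := fun _ => (2 ^ q : ℤ))]
    · simp
    · intro a ha
      rw [Finset.sum_comm, Finset.sum_congr rfl fun b hb =>
        sum_sylvester_mul q a b (by simpa using hA ha) (by simpa using hA hb)]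
      simp [ha]
  have h3 := Finset.sum_le_sum_of_subset_of_nonneg hX
    (f := fun x => (∑ a ∈ A, sylvester q a x) ^ 2) fun _ _ _ => sq_nonneg _
  rw [h1, h2] at h3
  have hpos : (0 : ℤ) < A.card := by exact_mod_cast hne.card_pos
  have h4 : (A.card : ℤ) * X.card ≤ 2 ^ q := by
    refine le_of_mul_le_mul_left ?_ hpos
    linarith
  exact_mod_cast h4

/-! ### Greedy matchings and disjoint paths through levels -/

/-- If any `s` vertices of `X` and any `s` vertices of `Y` span an edge, then all but `s` vertices
can be matched. -/
theorem exists_matching {α β : Type*} [DecidableEq α] [DecidableEq β] (R : α → β → Prop) (s d : ℕ)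
    (X : Finset α) (Y : Finset β)
    (h : ∀ X' ⊆ X, ∀ Y' ⊆ Y, s ≤ X'.card → s ≤ Y'.card → ∃ x ∈ X', ∃ y ∈ Y', R x y)
    (hX : d + s ≤ X.card) (hY : d + s ≤ Y.card) :
    ∃ (f : Fin d → α) (g : Fin d → β), f.Injective ∧ g.Injective ∧
      ∀ i, f i ∈ X ∧ g i ∈ Y ∧ R (f i) (g i) := by
  induction d generalizing X Y with
  | zero => exact ⟨Fin.elim0, Fin.elim0, fun i => i.elim0, fun i => i.elim0, fun i => i.elim0⟩
  | succ d ih =>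
    obtain ⟨x, hx, y, hy, hxy⟩ := h X subset_rfl Y subset_rfl (by omega) (by omega)
    obtain ⟨f, g, hf, hg, hfg⟩ := ih (X.erase x) (Y.erase y)
      (fun X' hX' Y' hY' => h X' (hX'.trans (X.erase_subset x)) Y' (hY'.trans (Y.erase_subset y)))
      (by rw [Finset.card_erase_of_mem hx]; omega) (by rw [Finset.card_erase_of_mem hy]; omega)
    simp only [Finset.mem_erase] at hfg
    refine ⟨Fin.cons x f, Fin.cons y g, Fin.cons_injective_iff.2 ⟨?_, hf⟩,
      Fin.cons_injective_iff.2 ⟨?_, hg⟩, Fin.cases ⟨hx, hy, hxy⟩ fun i => ?_⟩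
    · rintro ⟨i, hi⟩
      exact (hfg i).1.1 hi
    · rintro ⟨i, hi⟩
      exact (hfg i).2.1.1 hi
    · simpa using ⟨(hfg i).1.2, (hfg i).2.1.2, (hfg i).2.2⟩

/-- Disjoint transversal paths through a sequence of levels, if any `s` vertices of a level and any
`s` vertices of the next one span an edge. -/
theorem exists_level_paths {α : Type*} [DecidableEq α] (L : ℕ → Finset α) (R : ℕ → α → α → Prop)
    (s τ ℓ d : ℕ) (hτ : ∀ i ≤ ℓ, τ ≤ (L i).card)
    (h : ∀ i < ℓ, ∀ X ⊆ L i, ∀ Y ⊆ L (i + 1), s ≤ X.card → s ≤ Y.card →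
      ∃ x ∈ X, ∃ y ∈ Y, R i x y) (hd : d + ℓ * s ≤ τ) :
    ∃ P : Fin d → ℕ → α, (∀ j, ∀ i ≤ ℓ, P j i ∈ L i) ∧
      (∀ j, ∀ i < ℓ, R i (P j i) (P j (i + 1))) ∧
      ∀ i ≤ ℓ, Function.Injective fun j => P j i := by
  induction ℓ generalizing d with
  | zero =>
    have h0 : d ≤ (L 0).card := by have := hτ 0 le_rfl; omega
    refine ⟨fun j _ => (L 0).equivFin.symm (Fin.castLE h0 j), ?_, by simp, ?_⟩
    · intro j i hi
      obtain rfl : i = 0 := by omega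
      exact Subtype.coe_prop _
    · intro i _ j j' hj
      simpa [Subtype.coe_inj] using hj
  | succ ℓ ih =>
    -- The next matching may lose `s` paths, so `s` extra ones are requested here.
    obtain ⟨P, hL, hR, hinj⟩ := ih (d + s) (fun i hi => hτ i (by omega))
      (fun i hi => h i (by omega)) (by rw [add_mul] at hd; omega)
    have hsub : (Finset.univ.image fun j => P j ℓ) ⊆ L ℓ :=
      Finset.image_subset_iff.2 fun j _ => hL j ℓ le_rfl
    obtain ⟨f, g, hf, hg, hfg⟩ := exists_matching (R ℓ) s d
      (Finset.univ.image fun j => P j ℓ) (L (ℓ + 1))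
      (fun X hX Y hY => h ℓ (by omega) X (hX.trans hsub) Y hY)
      (by rw [Finset.card_image_of_injective _ (hinj ℓ le_rfl)]; simp)
      (by have := hτ (ℓ + 1) le_rfl; rw [add_mul] at hd; omega)
    simp only [Finset.mem_image, Finset.mem_univ, true_and] at hfg
    choose π hπ using fun i => (hfg i).1
    have hπi : Function.Injective π := fun i j hij => hf (by rw [← hπ, ← hπ, hij])
    refine ⟨fun j => Function.update (P (π j)) (ℓ + 1) (g j), ?_, ?_, ?_⟩
    · intro j i hi
      beta_reduce
      rcases Nat.lt_or_ge i (ℓ + 1) with hi' | hi'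
      · rw [Function.update_of_ne (by omega)]
        exact hL _ _ (by omega)
      · obtain rfl : i = ℓ + 1 := by omega
        simpa using (hfg j).2.1
    · intro j i hi
      beta_reduce
      rw [Function.update_of_ne (by omega)]
      rcases Nat.lt_or_ge i ℓ with hi' | hi'
      · rw [Function.update_of_ne (by omega)]
        exact hR _ _ hi'
      · obtain rfl : i = ℓ := by omega
        simpa [hπ] using (hfg j).2.2
    · intro i hi
      rcases Nat.lt_or_ge i (ℓ + 1) with hi' | hi'
      · simp only [Function.update_of_ne (show i ≠ ℓ + 1 by omega)]
        exact (hinj i (by omega)).comp hπi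
      · obtain rfl : i = ℓ + 1 := by omega
        simpa using hg

/-! ### Equidistributed labellings -/

/-- A finite set can be labelled so that each label occurs the average number of times, rounded
down. -/
theorem exists_equidistributed {α ι : Type*} [DecidableEq α] [Fintype ι] [DecidableEq ι]
    [Nonempty ι] (X : Finset α) :
    ∃ g : α → ι, ∀ j, X.card / Fintype.card ι ≤ (X.filter fun x => g x = j).card := by
  obtain ⟨e⟩ : Nonempty (ι × Fin (X.card / Fintype.card ι) ↪ X) := by
    apply Function.Embedding.nonempty_of_card_le
    simpa using Nat.mul_div_le _ _
  have he : Function.Injective fun p => (e p : α) := Subtype.val_injective.comp e.injective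
  -- The elements left over by the division get an arbitrary label.
  refine ⟨Function.extend (fun p => (e p : α)) Prod.fst fun _ => Classical.arbitrary ι, fun j => ?_⟩
  calc X.card / Fintype.card ι
      = (Finset.univ.image fun i : Fin (X.card / Fintype.card ι) => (e (j, i) : α)).card := by
        rw [Finset.card_image_of_injective, Finset.card_fin]
        exact fun a b hab => (Prod.ext_iff.1 (he hab)).2
    _ ≤ _ := by
        refine Finset.card_le_card fun x hx => ?_
        simp only [Finset.mem_image, Finset.mem_univ, true_and] at hx
        obtain ⟨i, rfl⟩ := hx
        exact Finset.mem_filter.2 ⟨Subtype.coe_prop _, he.extend_apply _ _ (j, i)⟩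

/-- A labelling that is equidistributed in every fibre of a given function. -/
theorem exists_equidistributed_fibers {α β ι : Type*} [DecidableEq α] [DecidableEq β] [Fintype ι]
    [DecidableEq ι] [Nonempty ι] (X : Finset α) (f : α → β) :
    ∃ g : α → ι, ∀ c j, (X.filter fun x => f x = c).card / Fintype.card ι ≤
      (X.filter fun x => f x = c ∧ g x = j).card := by
  choose g hg using fun c => exists_equidistributed (ι := ι) (X.filter fun x => f x = c)
  refine ⟨fun x => g (f x) x, fun c j => (hg c j).trans (Finset.card_le_card fun x hx => ?_)⟩
  simp only [Finset.mem_filter] at hx ⊢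
  obtain ⟨⟨hx, rfl⟩, hj⟩ := hx
  exact ⟨hx, rfl, hj⟩

/-! ### Systems of alternating paths from vertex sequences and levels -/

variable {V K : Type*} {G : SimpleGraph V}

theorem exists_walk_getVert_eq (g : ℕ → V) (ℓ : ℕ) (h : ∀ i < ℓ, G.Adj (g i) (g (i + 1))) :
    ∃ p : G.Walk (g 0) (g ℓ), p.length = ℓ ∧ ∀ i ≤ ℓ, p.getVert i = g i := by
  induction ℓ generalizing g with
  | zero => exact ⟨.nil, rfl, fun i hi => by simp [Nat.le_zero.1 hi]⟩
  | succ ℓ ih =>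
    obtain ⟨p, hp, hv⟩ := ih (fun i => g (i + 1)) fun i hi => h (i + 1) (by omega)
    refine ⟨.cons (h 0 (by omega)) p, by simp [hp], fun i hi => ?_⟩
    cases i with
    | zero => simp
    | succ i => simpa using hv i (by omega)

theorem exists_alternating_path (c : G.EdgeLabeling K) (g : ℕ → V) (ℓ : ℕ)
    (h : ∀ i < ℓ, G.Adj (g i) (g (i + 1))) (hinj : Set.InjOn g {i | i ≤ ℓ})
    (hc : ∀ i, ∀ hi : i + 1 < ℓ, c ⟨s(g i, g (i + 1)), h i (by omega)⟩ ≠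
      c ⟨s(g (i + 1), g (i + 2)), h (i + 1) hi⟩) :
    ∃ p : G.Walk (g 0) (g ℓ), p.IsPath ∧ p.length = ℓ ∧ IsAlternating c p ∧
      ∀ x, x ∈ p.support ↔ ∃ i ≤ ℓ, g i = x := by
  obtain ⟨p, hp, hv⟩ := exists_walk_getVert_eq g ℓ h
  refine ⟨p, ?_, hp, ?_, fun x => ?_⟩
  · rw [← SimpleGraph.Walk.IsPath.getVert_injOn_iff, hp]
    exact hinj.congr fun i hi => (hv i hi).symm
  · rw [IsAlternating, List.isChain_iff_getElem]
    intro i hi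
    rw [SimpleGraph.Walk.length_darts, hp] at hi
    have := hc i hi
    simp only [SimpleGraph.Walk.darts_getElem_eq_getVert, SimpleGraph.Dart.edge_mk]
    simpa only [hv i (by omega), hv (i + 1) (by omega), hv (i + 1 + 1) (by omega)] using this
  · rw [SimpleGraph.Walk.mem_support_iff_exists_getVert, hp]
    exact ⟨fun ⟨i, hi, hl⟩ => ⟨i, hl, hv i hl ▸ hi⟩, fun ⟨i, hl, hi⟩ => ⟨i, (hv i hl).trans hi, hl⟩⟩

theorem joinedBy_of_vertices {ι : Type*} [Fintype ι] {t ℓ : ℕ} (hι : Fintype.card ι = t)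
    (hℓ : 2 ≤ ℓ) (c : G.EdgeLabeling K) {u v : V} (huv : u ≠ v) (g : ι → ℕ → V)
    (h0 : ∀ a, g a 0 = u) (h1 : ∀ a, g a ℓ = v)
    (hin : ∀ a b i j, 0 < i → i < ℓ → 0 < j → j < ℓ → g a i = g b j → a = b ∧ i = j)
    (hu : ∀ a i, 0 < i → i < ℓ → g a i ≠ u) (hv : ∀ a i, 0 < i → i < ℓ → g a i ≠ v)
    (h : ∀ a, ∀ i < ℓ, G.Adj (g a i) (g a (i + 1)))
    (hc : ∀ a i, ∀ hi : i + 1 < ℓ, c ⟨s(g a i, g a (i + 1)), h a i (by omega)⟩ ≠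
      c ⟨s(g a (i + 1), g a (i + 2)), h a (i + 1) hi⟩) :
    JoinedBy c ℓ t u v := by
  have key : ∀ a, ∃ p : G.Walk u v, p.IsPath ∧ p.length = ℓ ∧ IsAlternating c p ∧
      ∀ x, x ∈ p.support ↔ ∃ i ≤ ℓ, g a i = x := by
    intro a
    have hinj : Set.InjOn (g a) {i | i ≤ ℓ} := by
      intro i hi j hj hij
      simp only [Set.mem_ofPred_eq] at hi hj
      rcases Nat.eq_zero_or_pos i with rfl | hi0 <;> rcases Nat.eq_zero_or_pos j with rfl | hj0
      · rfl
      · rcases hj.eq_or_lt with rfl | hj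
        · exact absurd (by rw [← h0 a, ← h1 a, hij]) huv
        · exact absurd (by rw [← hij, h0 a]) (hu a j hj0 hj)
      · rcases hi.eq_or_lt with rfl | hi
        · exact absurd (by rw [← h0 a, ← h1 a, hij]) huv
        · exact absurd (by rw [hij, h0 a]) (hu a i hi0 hi)
      · rcases hi.eq_or_lt with rfl | hi <;> rcases hj.eq_or_lt with hj | hj
        · exact hj.symm
        · exact absurd (by rw [← hij, h1 a]) (hv a j hj0 hj)
        · subst hj
          exact absurd (by rw [hij, h1 a]) (hv a i hi0 hi)
        · exact (hin a a i j hi0 hi hj0 hj hij).2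
    have := exists_alternating_path c (g a) ℓ (h a) hinj (hc a)
    rwa [h0, h1] at this
  choose p hp hl ha hs using key
  have hd : ∀ a b, a ≠ b → ∀ x, x ∈ (p a).support → x ∈ (p b).support → x = u ∨ x = v := by
    intro a b hab x hx hx'
    obtain ⟨i, hi, rfl⟩ := (hs a x).1 hx
    obtain ⟨j, hj, hij⟩ := (hs b _).1 hx'
    by_contra! hne
    have e0 : ∀ (a' : ι) (i' : ℕ), g a' i' ≠ u → g a' i' ≠ v → i' ≤ ℓ → 0 < i' ∧ i' < ℓ := by
      intro a' i' h' h'' hle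
      refine ⟨Nat.pos_of_ne_zero ?_, lt_of_le_of_ne hle ?_⟩
      · rintro rfl
        exact h' (h0 a')
      · rintro rfl
        exact h'' (h1 a')
    have e1 := e0 a i hne.1 hne.2 hi
    have e2 := e0 b j (hij ▸ hne.1) (hij ▸ hne.2) hj
    exact hab (hin a b i j e1.1 e1.2 e2.1 e2.2 hij.symm).1
  let e := Fintype.equivFinOfCardEq hι
  refine ⟨fun i => p (e.symm i), fun i j hij => ?_, fun i => ⟨hp _, hl _, ha _⟩,
    fun i j hij => hd _ _ (e.symm.injective.ne hij)⟩
  by_contra hne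
  -- Equal walks would share the vertex at position 1, which is internal because `2 ≤ ℓ`.
  have hx := (hs (e.symm i) (g (e.symm i) 1)).2 ⟨1, by omega, rfl⟩
  have hx' := hx
  simp only at hij
  rw [hij] at hx'
  rcases hd _ _ (e.symm.injective.ne hne) _ hx hx' with h | h
  · exact hu _ _ one_pos (by omega) h
  · exact hv _ _ one_pos (by omega) h

/-- Two vertices are joined by `2 * d` alternating paths, if there are two systems of large levels
between them, one for each colour of the first edge, and consecutive levels are well connected in
the colour prescribed by the alternation. -/
theorem joinedBy_of_levels [DecidableEq V] (c : G.EdgeLabeling K) (pal : Bool → K)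
    (hpal : pal.Injective) (w : V → V → Bool)
    (hw : ∀ x y, ∀ h : G.Adj x y, c ⟨s(x, y), h⟩ = pal (w x y)) {u v : V} (huv : u ≠ v)
    (ℓ s τ d : ℕ) (L : Bool → ℕ → Finset V)
    (hdisj : ∀ b b' i i' x, i ≤ ℓ → i' ≤ ℓ → x ∈ L b i → x ∈ L b' i' → b = b' ∧ i = i')
    (hu : ∀ b, ∀ i ≤ ℓ, u ∉ L b i) (hv : ∀ b, ∀ i ≤ ℓ, v ∉ L b i)
    (hτ : ∀ b, ∀ i ≤ ℓ, τ ≤ (L b i).card)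
    (hstart : ∀ b, ∀ x ∈ L b 0, G.Adj u x ∧ w u x = b)
    (hend : ∀ b, ∀ x ∈ L b ℓ, G.Adj x v ∧ w x v = xor b (ℓ + 1).bodd)
    (hmix : ∀ b, ∀ i < ℓ, ∀ X ⊆ L b i, ∀ Y ⊆ L b (i + 1), s ≤ X.card → s ≤ Y.card →
      ∃ x ∈ X, ∃ y ∈ Y, G.Adj x y ∧ w x y = xor b (i + 1).bodd)
    (hd : d + ℓ * s ≤ τ) : JoinedBy c (ℓ + 2) (2 * d) u v := by
  choose P hPL hPR hPi using fun b => exists_level_paths (L b)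
    (fun i x y => G.Adj x y ∧ w x y = xor b (i + 1).bodd) s τ ℓ d (hτ b) (hmix b) hd
  let g : Bool × Fin d → ℕ → V := fun a i =>
    if i = 0 then u else if i ≤ ℓ + 1 then P a.1 a.2 (i - 1) else v
  have g0 : ∀ a, g a 0 = u := fun a => if_pos rfl
  have g1 : ∀ a, g a (ℓ + 2) = v := fun a => by simp [g]
  have gi : ∀ a, ∀ i ≤ ℓ, g a (i + 1) = P a.1 a.2 i := fun a i hi => by simp [g, hi]
  have gi' : ∀ a i, 0 < i → i < ℓ + 2 → ∃ j ≤ ℓ, i = j + 1 ∧ g a i = P a.1 a.2 j := by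
    intro a i hi hi'
    obtain ⟨j, rfl⟩ : ∃ j, i = j + 1 := ⟨i - 1, by omega⟩
    exact ⟨j, by omega, rfl, gi a j (by omega)⟩
  -- Level `i` sits at position `i + 1` of the path, hence the shift of the parity in `hmix` and
  -- `hend`.
  have hstep : ∀ a, ∀ i < ℓ + 2, G.Adj (g a i) (g a (i + 1)) ∧
      w (g a i) (g a (i + 1)) = xor a.1 i.bodd := by
    intro a i hi
    rcases Nat.eq_zero_or_pos i with rfl | hi0
    · rw [g0, gi a 0 (by omega)]
      simpa using hstart a.1 _ (hPL a.1 a.2 0 (by omega))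
    · obtain ⟨j, hj, rfl, e⟩ := gi' a i hi0 hi
      rw [e]
      rcases hj.eq_or_lt with rfl | hj
      · rw [g1]
        exact hend _ _ (hPL a.1 a.2 j le_rfl)
      · rw [gi a (j + 1) (by omega)]
        exact hPR a.1 a.2 j hj
  refine joinedBy_of_vertices (ι := Bool × Fin d) (by simp) (by omega) c huv g g0 g1 ?_ ?_ ?_
    (fun a i hi => (hstep a i hi).1) ?_
  · intro a b i j hi hi' hj hj' hij
    obtain ⟨i, hiℓ, rfl, e⟩ := gi' a i hi hi'
    obtain ⟨j, hjℓ, rfl, e'⟩ := gi' b j hj hj'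
    rw [e, e'] at hij
    obtain ⟨h1, rfl⟩ := hdisj a.1 b.1 i j (P a.1 a.2 i) hiℓ hjℓ (hPL _ _ _ hiℓ)
      (by rw [hij]; exact hPL _ _ _ hjℓ)
    rw [← h1] at hij
    exact ⟨Prod.ext h1 (hPi a.1 i hiℓ hij), rfl⟩
  · intro a i hi hi' h
    obtain ⟨i, hiℓ, rfl, e⟩ := gi' a i hi hi'
    exact hu a.1 i hiℓ (h ▸ e ▸ hPL _ _ _ hiℓ)
  · intro a i hi hi' h
    obtain ⟨i, hiℓ, rfl, e⟩ := gi' a i hi hi'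
    exact hv a.1 i hiℓ (h ▸ e ▸ hPL _ _ _ hiℓ)
  · intro a i hi h
    rw [hw, hw] at h
    have := hpal h
    rw [(hstep a i (by omega)).2, (hstep a (i + 1) hi).2, Nat.bodd_succ] at this
    revert this
    cases a.1 <;> cases i.bodd <;> simp

/-! ### Colourings of `K_{m,n}` given by 0-1 matrices -/

/-- The entry of a 0-1 matrix that belongs to a pair of vertices of `K_{m,n}`. -/
def entry {m n : ℕ} (M : Fin m → Fin n → Bool) : Fin m ⊕ Fin n → Fin m ⊕ Fin n → Bool
  | .inl a, .inr x => M a x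
  | .inr x, .inl a => M a x
  | _, _ => false

theorem entry_comm {m n : ℕ} (M : Fin m → Fin n → Bool) (y z : Fin m ⊕ Fin n) :
    entry M y z = entry M z y := by
  rcases y with a | x <;> rcases z with b | y <;> rfl

/-- The colouring of `K_{m,n}` with two colours `pal true` and `pal false` given by a 0-1 matrix. -/
def matrixColoring {m n : ℕ} {K : Type*} (pal : Bool → K) (M : Fin m → Fin n → Bool) :
    (Kmn m n).EdgeLabeling K :=
  fun e => pal (Sym2.lift ⟨entry M, entry_comm M⟩ e.1)

theorem card_filter_eq_add {α : Type*} (X : Finset α) (P : α → Prop) [DecidablePred P]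
    (q : α → Bool) : (X.filter P).card =
      (X.filter fun x => P x ∧ q x = true).card + (X.filter fun x => P x ∧ q x = false).card := by
  have := Finset.card_filter_add_card_filter_not (s := X.filter P) (fun x => q x = true)
  simpa only [Finset.filter_filter, Bool.not_eq_true] using this.symm

/-- A labelling of the rows with `k` labels that is almost equidistributed on both classes of each
of two given columns. -/
theorem exists_row_labels {m k : ℕ} (hk : 1 ≤ k) (p q : Fin m → Bool) :
    ∃ ρ : Fin m → ℕ, ∀ b, ∀ j < k,
      (Finset.univ.filter fun a => p a = b).card / k - 1 ≤
        (Finset.univ.filter fun a => p a = b ∧ ρ a = j).card ∧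
      (Finset.univ.filter fun a => q a = b).card / k - 1 ≤
        (Finset.univ.filter fun a => q a = b ∧ ρ a = j).card := by
  have : Nonempty (Fin k) := ⟨⟨0, hk⟩⟩
  obtain ⟨g, hg⟩ := exists_equidistributed_fibers (ι := Fin k) Finset.univ fun a => (p a, q a)
  -- Labels are equidistributed in the four cells of `(p, q)`; a class of `p` or `q` is a union of
  -- two cells, and rounding down twice costs at most 1.
  have hdiv : ∀ c₁ c₂ : ℕ, (c₁ + c₂) / k - 1 ≤ c₁ / k + c₂ / k := by
    intro c₁ c₂
    have h1 := Nat.div_add_mod c₁ k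
    have h2 := Nat.div_add_mod c₂ k
    have h3 := Nat.mod_lt c₁ hk
    have h4 := Nat.mod_lt c₂ hk
    have : (c₁ + c₂) / k < c₁ / k + c₂ / k + 2 := by
      rw [Nat.div_lt_iff_lt_mul hk]
      nlinarith
    exact Nat.sub_le_iff_le_add.2 (Nat.lt_succ_iff.1 this)
  refine ⟨fun a => g a, fun b j hj => ?_⟩
  have hg' : ∀ b₁ b₂, (Finset.univ.filter fun a => p a = b₁ ∧ q a = b₂).card / k ≤
      (Finset.univ.filter fun a => (p a = b₁ ∧ q a = b₂) ∧ (g a : ℕ) = j).card := by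
    intro b₁ b₂
    have := hg (b₁, b₂) ⟨j, hj⟩
    simpa [Fin.ext_iff, Prod.ext_iff] using this
  constructor
  · rw [card_filter_eq_add _ _ q, card_filter_eq_add _ (fun a => p a = b ∧ (g a : ℕ) = j) q]
    refine (hdiv _ _).trans ((add_le_add (hg' b true) (hg' b false)).trans_eq ?_)
    simp only [and_right_comm]
  · rw [card_filter_eq_add _ _ p, card_filter_eq_add _ (fun a => q a = b ∧ (g a : ℕ) = j) p]
    refine (hdiv _ _).trans (le_trans ?_ ((add_le_add (hg' true b) (hg' false b)).trans_eq ?_))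
    · simp only [and_comm (a := q _ = b)]
      exact le_rfl
    · simp only [and_right_comm (c := (g _ : ℕ) = j), and_comm (a := q _ = b)]
      simp only [and_comm, and_left_comm]

/-- A labelling of the columns with index less than `m`, other than `u` and `v`. -/
theorem exists_column_labels {m n k : ℕ} (hk : 2 ≤ k) (hmn : m ≤ n) (u v : Fin n) :
    ∃ χ : Fin n → Bool × ℕ, ∀ b, ∀ j < k - 1, m / (2 * k) - 1 ≤
      (Finset.univ.filter fun x : Fin n => (x.val < m ∧ x ≠ u ∧ x ≠ v) ∧ χ x = (b, j)).card := by
  have : Nonempty (Fin (k - 1)) := ⟨⟨0, by omega⟩⟩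
  obtain ⟨g, hg⟩ := exists_equidistributed (ι := Bool × Fin (k - 1))
    (Finset.univ.filter fun x : Fin n => x.val < m ∧ x ≠ u ∧ x ≠ v)
  have hcard : m - 2 ≤ (Finset.univ.filter fun x : Fin n => x.val < m ∧ x ≠ u ∧ x ≠ v).card := by
    have h1 : ((Finset.univ.map (Fin.castLEEmb hmn)) \ {u, v}) ⊆
        Finset.univ.filter fun x : Fin n => x.val < m ∧ x ≠ u ∧ x ≠ v := by
      intro x hx
      simp only [Finset.mem_sdiff, Finset.mem_map, Finset.mem_univ, true_and, Finset.mem_insert,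
        Finset.mem_singleton, not_or] at hx
      obtain ⟨⟨i, rfl⟩, hu, hv⟩ := hx
      simp only [Finset.mem_filter, Finset.mem_univ, true_and]
      exact ⟨i.2, hu, hv⟩
    have h2 := Finset.card_le_card h1
    have h3 := Finset.le_card_sdiff {u, v} (Finset.univ.map (Fin.castLEEmb hmn))
    have h4 := Finset.card_le_two (a := u) (b := v)
    simp only [Finset.card_map, Finset.card_univ, Fintype.card_fin] at h3
    omega
  refine ⟨fun x => ((g x).1, (g x).2), fun b j hj => ?_⟩
  have h := hg (b, ⟨j, hj⟩)
  simp only [Fintype.card_prod, Fintype.card_bool, Fintype.card_fin, Finset.filter_filter,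
    Prod.ext_iff, Fin.ext_iff] at h
  simp only [Prod.ext_iff]
  refine le_trans ?_ h
  refine le_trans ?_ (Nat.div_le_div_right hcard)
  obtain ⟨k, rfl⟩ : ∃ k', k = k' + 2 := ⟨k - 2, by omega⟩
  -- There are `2(k - 1) ≥ 2` labels, so losing the two columns `u` and `v` lowers the quotient by
  -- at most 1.
  rw [Nat.sub_le_iff_le_add]
  have hp : 0 < 2 * (k + 2 - 1) := by omega
  calc m / (2 * (k + 2)) ≤ m / (2 * (k + 2 - 1)) := Nat.div_le_div_left (by omega) hp
    _ ≤ (m - 2 + 2 * (k + 2 - 1)) / (2 * (k + 2 - 1)) := Nat.div_le_div_right (by omega)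
    _ = _ := Nat.add_div_right _ hp

/-- If each column of `M` is balanced and there are no large constant submatrices, then the
colouring given by `M` connects the vertices of the second class by many alternating paths. -/
theorem connects_matrixColoring {m n k s d : ℕ} {K : Type*} (hk : 2 ≤ k) (hmn : m ≤ n)
    (pal : Bool → K) (hpal : pal.Injective) (M : Fin m → Fin n → Bool)
    (hbal : ∀ x b, m / 2 ≤ (Finset.univ.filter fun a => M a x = b).card)
    (hmix : ∀ (A : Finset (Fin m)) (X : Finset (Fin n)), (∀ x ∈ X, x.val < m) → s ≤ A.card →
      s ≤ X.card → ∀ b, ∃ a ∈ A, ∃ x ∈ X, M a x = b)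
    (hd : d + (2 * k - 2) * s ≤ m / (2 * k) - 1) :
    Connects (matrixColoring pal M) (2 * k) (2 * d) := by
  intro u v huv
  obtain ⟨ρ, hρ⟩ := exists_row_labels (k := k) (by omega) (fun a => M a u) (fun a => M a v)
  obtain ⟨χ, hχ⟩ := exists_column_labels hk hmn u v
  -- Only the injectivity of this relabelling of `0, …, k - 1` matters: distinct row levels get
  -- distinct labels, while for equal `j` the colour at `u` or `v` separates the two values of `b`.
  let lab : ℕ → ℕ := fun j => if j = k - 1 then 1 else if j = 0 then 0 else j + 1
  have hlab : ∀ j < k, lab j < k := by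
    intro j hj
    simp only [lab]
    split_ifs <;> omega
  have hlab_inj : ∀ i < k, ∀ j < k, lab i = lab j → i = j := by
    intro i hi j hj h
    simp only [lab] at h
    split_ifs at h <;> omega
  let row : Bool → ℕ → Finset (Fin m) := fun b j =>
    Finset.univ.filter fun a => (if j = k - 1 then M a v = !b else M a u = b) ∧ ρ a = lab j
  let column : Bool → ℕ → Finset (Fin n) := fun b j =>
    Finset.univ.filter fun x => (x.val < m ∧ x ≠ u ∧ x ≠ v) ∧ χ x = (b, j)
  let L : Bool → ℕ → Finset (Fin m ⊕ Fin n) := fun b i =>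
    if i % 2 = 0 then (row b (i / 2)).map .inl else (column b (i / 2)).map .inr
  have mem_inl : ∀ a b i, .inl a ∈ L b i ↔ i % 2 = 0 ∧ a ∈ row b (i / 2) := by
    intro a b i
    by_cases h : i % 2 = 0 <;> simp [L, h]
  have mem_inr : ∀ x b i, .inr x ∈ L b i ↔ i % 2 = 1 ∧ x ∈ column b (i / 2) := by
    intro x b i
    by_cases h : i % 2 = 0 <;> simp [L, h]
    intro h'
    omega
  have mem_row : ∀ a b j, a ∈ row b j ↔
      (if j = k - 1 then M a v = !b else M a u = b) ∧ ρ a = lab j := by simp [row]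
  have mem_column : ∀ x b j, x ∈ column b j ↔
      (x.val < m ∧ x ≠ u ∧ x ≠ v) ∧ χ x = (b, j) := by simp [column]
  have hrow : ∀ b, ∀ j < k, m / (2 * k) - 1 ≤ (row b j).card := by
    intro b j hj
    have h2 : ∀ x b, m / (2 * k) - 1 ≤ (Finset.univ.filter fun a => M a x = b).card / k - 1 := by
      intro x b
      rw [← Nat.div_div_eq_div_mul]
      exact Nat.sub_le_sub_right (Nat.div_le_div_right (hbal x b)) 1
    by_cases h : j = k - 1
    · simp only [row, h, if_true]
      exact (h2 v (!b)).trans (hρ (!b) _ (hlab _ (by omega))).2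
    · simp only [row, h, if_false]
      exact (h2 u b).trans (hρ b _ (hlab _ hj)).1
  have key := joinedBy_of_levels (matrixColoring pal M) pal hpal (entry M) (fun x y h => rfl)
    (u := .inr u) (v := .inr v) (by simpa using huv) (2 * k - 2) s (m / (2 * k) - 1) d L
    ?_ ?_ ?_ ?_ ?_ ?_ ?_ hd
  · rwa [show 2 * k - 2 + 2 = 2 * k by omega] at key
  · intro b b' i i' x hi hi' hx hx'
    rcases x with a | x
    · rw [mem_inl, mem_row] at hx hx'
      have hij := hlab_inj (i / 2) (by omega) (i' / 2) (by omega) (hx.2.2.symm.trans hx'.2.2)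
      refine ⟨?_, by omega⟩
      have h1 := hx.2.1
      have h2 := hx'.2.1
      rw [← hij] at h2
      split_ifs at h1 h2
      · exact Bool.not_inj (h1.symm.trans h2)
      · exact h1.symm.trans h2
    · rw [mem_inr, mem_column] at hx hx'
      have hij := Prod.ext_iff.1 (hx.2.2.symm.trans hx'.2.2)
      simp only at hij
      exact ⟨hij.1, by omega⟩
  · intro b i _ hx
    rw [mem_inr, mem_column] at hx
    exact hx.2.1.2.1 rfl
  · intro b i _ hx
    rw [mem_inr, mem_column] at hx
    exact hx.2.1.2.2 rfl
  · intro b i hi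
    simp only [L]
    split_ifs
    · rw [Finset.card_map]
      exact hrow b _ (by omega)
    · rw [Finset.card_map]
      exact hχ b _ (by omega)
  · intro b x hx
    rcases x with a | x
    · rw [mem_inl, mem_row, if_neg (by omega)] at hx
      exact ⟨by simp, hx.2.1⟩
    · rw [mem_inr] at hx
      omega
  · intro b x hx
    rcases x with a | x
    · rw [mem_inl, mem_row, if_pos (by omega)] at hx
      refine ⟨by simp, hx.2.1.trans ?_⟩
      rw [show 2 * k - 2 + 1 = 2 * (k - 1) + 1 by omega]
      simp
    · rw [mem_inr] at hx
      omega
  · intro b i hi X hX Y hY hXs hYs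
    by_cases h : i % 2 = 0
    · simp only [L, h, if_true] at hX
      simp only [L, show ¬ (i + 1) % 2 = 0 by omega, if_false] at hY
      obtain ⟨A, hA, rfl⟩ := Finset.subset_map_iff.1 hX
      obtain ⟨B, hB, rfl⟩ := Finset.subset_map_iff.1 hY
      rw [Finset.card_map] at hXs hYs
      obtain ⟨a, ha, x, hx, hax⟩ := hmix A B (fun x hx => ((mem_column _ _ _).1 (hB hx)).1.1)
        hXs hYs (xor b (i + 1).bodd)
      exact ⟨.inl a, Finset.mem_map_of_mem _ ha, .inr x, Finset.mem_map_of_mem _ hx, by simp, hax⟩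
    · simp only [L, h, if_false] at hX
      simp only [L, show (i + 1) % 2 = 0 by omega, if_true] at hY
      obtain ⟨B, hB, rfl⟩ := Finset.subset_map_iff.1 hX
      obtain ⟨A, hA, rfl⟩ := Finset.subset_map_iff.1 hY
      rw [Finset.card_map] at hXs hYs
      obtain ⟨a, ha, x, hx, hax⟩ := hmix A B (fun x hx => ((mem_column _ _ _).1 (hB hx)).1.1)
        hYs hXs (xor b (i + 1).bodd)
      exact ⟨.inr x, Finset.mem_map_of_mem _ hx, .inl a, Finset.mem_map_of_mem _ ha, by simp, hax⟩

theorem ncard_range_matrixColoring_le {m n : ℕ} {K : Type*} (pal : Bool → K)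
    (M : Fin m → Fin n → Bool) : (Set.range (matrixColoring pal M)).ncard ≤ 2 := by
  have hsub : Set.range (matrixColoring pal M) ⊆ {pal true, pal false} := by
    rintro _ ⟨e, rfl⟩
    simp only [matrixColoring]
    cases Sym2.lift ⟨entry M, entry_comm M⟩ e.1 <;> simp
  refine (Set.ncard_le_ncard hsub).trans ((Set.ncard_insert_le _ _).trans ?_)
  simp

/-! ### The Hadamard colouring -/

/-- The 0-1 matrix formed by the first `m` rows and the columns of odd index of the
Sylvester–Hadamard matrix of order `2 ^ (q + 1)`. -/
def hadamardBit (q m n : ℕ) (a : Fin m) (x : Fin n) : Bool :=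
  decide (sylvester (q + 1) a (2 * x + 1) = 1)

theorem sylvester_eq_ite (q m n : ℕ) (a : Fin m) (x : Fin n) :
    sylvester (q + 1) a (2 * x + 1) = if hadamardBit q m n a x then 1 else -1 := by
  rcases sylvester_eq_or (q + 1) a (2 * x + 1) with h | h <;> simp [hadamardBit, h]

/-- Rows `2i` and `2i + 1` differ only in the last digit, so they have opposite signs in an odd
column. This holds for all columns, also those beyond the order of the matrix, so `u` and `v` may be
arbitrary. -/
theorem le_card_hadamardBit (q m n : ℕ) (x : Fin n) (b : Bool) :
    m / 2 ≤ (Finset.univ.filter fun a => hadamardBit q m n a x = b).card := by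
  have key : ∀ i : Fin (m / 2), ∃ a : Fin m, a.val / 2 = i.val ∧ hadamardBit q m n a x = b := by
    intro i
    let a₀ : Fin m := ⟨2 * i, by omega⟩
    let a₁ : Fin m := ⟨2 * i + 1, by omega⟩
    have hne : sylvester (q + 1) a₁ (2 * x + 1) = - sylvester (q + 1) a₀ (2 * x + 1) := by
      have h1 : (2 * i.val + 1) / 2 = i.val := by omega
      have h2 : (2 * i.val) / 2 = i.val := by omega
      have h3 : (2 * i.val + 1) % 2 = 1 := by omega
      have h4 : (2 * x.val + 1) % 2 = 1 := by omega
      simp [sylvester, a₀, a₁, h1, h3, h4]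
    rw [sylvester_eq_ite, sylvester_eq_ite] at hne
    by_cases hb : hadamardBit q m n a₀ x = b
    · exact ⟨a₀, by simp [a₀], hb⟩
    · refine ⟨a₁, by simp only [a₁]; omega, ?_⟩
      revert hne hb
      cases hadamardBit q m n a₀ x <;> cases hadamardBit q m n a₁ x <;> cases b <;> simp
  choose f hf hfb using key
  have hinj : Function.Injective f := fun i j hij => Fin.ext (by rw [← hf, ← hf, hij])
  calc m / 2 = (Finset.univ.image f).card := by
        rw [Finset.card_image_of_injective _ hinj, Finset.card_fin]
    _ ≤ _ := Finset.card_le_card fun a ha => by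
        obtain ⟨i, -, rfl⟩ := Finset.mem_image.1 ha
        simpa using hfb i

/-- Otherwise `A × X` would be a constant submatrix with too many entries. The bound `x < m` puts
the column `2x + 1` inside the matrix of order `2 ^ (q + 1)`, where orthogonality applies. -/
theorem exists_hadamardBit_eq {q m n s : ℕ} (hq : m ≤ 2 ^ q) (hs : 2 ^ (q + 1) < s * s)
    (A : Finset (Fin m)) (X : Finset (Fin n)) (hX : ∀ x ∈ X, x.val < m) (hAs : s ≤ A.card)
    (hXs : s ≤ X.card) (b : Bool) : ∃ a ∈ A, ∃ x ∈ X, hadamardBit q m n a x = b := by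
  by_contra! hne
  have hinj : Function.Injective fun x : Fin n => 2 * x.val + 1 := fun x y h => Fin.ext (by
    simp only at h; omega)
  have h := card_mul_card_le_of_sylvester_eq (q := q + 1) (A := A.image Fin.val)
    (X := X.image fun x => 2 * x.val + 1) (ε := if b then -1 else 1) ?_ ?_ ?_ ?_
  · rw [Finset.card_image_of_injective _ Fin.val_injective,
      Finset.card_image_of_injective _ hinj] at h
    exact absurd (hs.trans_le ((Nat.mul_le_mul hAs hXs).trans h)) (lt_irrefl _)
  · intro a ha
    obtain ⟨a, -, rfl⟩ := Finset.mem_image.1 ha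
    have := a.2
    rw [Finset.mem_range, pow_succ]
    omega
  · intro x hx
    obtain ⟨x, hxX, rfl⟩ := Finset.mem_image.1 hx
    have := hX x hxX
    rw [Finset.mem_range, pow_succ]
    omega
  · cases b <;> simp
  · intro a ha x hx
    obtain ⟨a, haA, rfl⟩ := Finset.mem_image.1 ha
    obtain ⟨x, hxX, rfl⟩ := Finset.mem_image.1 hx
    rw [sylvester_eq_ite]
    have := hne a haA x hxX
    revert this
    cases hadamardBit q m n a x <;> cases b <;> simp

theorem exists_two_coloring_connects {r k m n d : ℕ} (hr : 2 ≤ r) (hk : 2 ≤ k) (hm : 1 ≤ m)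
    (hmn : m ≤ n) (hd : d ≤ m / (2 * k) - 1 - (2 * k - 2) * (2 * (m.sqrt + 1))) :
    ∃ c : (Kmn m n).EdgeLabeling (Fin r),
      (Set.range c).ncard ≤ 2 ∧ Connects c (2 * k) (2 * d) := by
  let pal : Bool → Fin r := fun b => if b then ⟨0, by omega⟩ else ⟨1, by omega⟩
  have hpal : pal.Injective := by
    intro b b'
    cases b <;> cases b' <;> simp [pal]
  have hlow : m ≤ 2 ^ Nat.clog 2 m := Nat.le_pow_clog one_lt_two m
  have hup : 2 ^ Nat.clog 2 m ≤ 2 * m := by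
    rcases hm.eq_or_lt with rfl | hm
    · simp
    · have h1 := Nat.pow_pred_clog_lt_self one_lt_two hm
      have h2 : 0 < Nat.clog 2 m := Nat.clog_pos one_lt_two hm
      obtain ⟨l, hl⟩ : ∃ l, Nat.clog 2 m = l + 1 := ⟨_, (Nat.succ_pred_eq_of_pos h2).symm⟩
      rw [hl] at h1 ⊢
      rw [pow_succ]
      simp at h1
      omega
  -- For `0 < d` the truncated subtractions in `hd` are genuine, so `hd` can be rearranged.
  rcases Nat.eq_zero_or_pos d with rfl | hd0
  · exact ⟨matrixColoring pal fun _ _ => true, ncard_range_matrixColoring_le _ _, fun u v _ =>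
      ⟨fun i => i.elim0, fun i => i.elim0, fun i => i.elim0, fun i => i.elim0⟩⟩
  refine ⟨matrixColoring pal (hadamardBit (Nat.clog 2 m) m n),
    ncard_range_matrixColoring_le _ _, connects_matrixColoring (s := 2 * (m.sqrt + 1)) hk hmn pal
    hpal _ (le_card_hadamardBit _ m n) (exists_hadamardBit_eq hlow ?_) (by omega)⟩
  -- The order is at most `4m`, which is less than `(2(√m + 1)) ^ 2` with the integer square root.
  have := Nat.lt_succ_sqrt m
  simp only [Nat.succ_eq_add_one] at this
  rw [pow_succ]
  nlinarith

/-! ### The upper bound -/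

/-- The vertices at odd positions lie in the class of size `m`; being internal, they are distinct
over all `t` paths and `k` odd positions. -/
theorem mul_le_of_connects {K : Type*} {k m n t : ℕ} (hn : 2 ≤ n)
    (c : (Kmn m n).EdgeLabeling K) (hc : Connects c (2 * k) t) : k * t ≤ m := by
  obtain ⟨P, -, hP, hd⟩ := hc ⟨0, by omega⟩ ⟨1, by omega⟩ (by simp)
  have key : ∀ i, ∀ j ≤ k, ((P i).getVert (2 * j)).isRight = true := by
    intro i j hj
    induction j with
    | zero => simp
    | succ j ih =>
      have hl := (hP i).2.1
      have h1 := (P i).adj_getVert_succ (i := 2 * j) (by omega)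
      have h2 := (P i).adj_getVert_succ (i := 2 * j + 1) (by omega)
      have h3 := ih (by omega)
      rw [show 2 * (j + 1) = 2 * j + 1 + 1 by ring]
      simp only [completeBipartiteGraph_adj] at h1 h2
      revert h1 h2 h3
      cases (P i).getVert (2 * j) <;> cases (P i).getVert (2 * j + 1) <;>
        cases (P i).getVert (2 * j + 1 + 1) <;> simp
  have key' : ∀ p : Fin k × Fin t, ∃ a : Fin m, (P p.2).getVert (2 * p.1 + 1) = .inl a := by
    rintro ⟨j, i⟩
    have hl := (hP i).2.1
    have h1 := (P i).adj_getVert_succ (i := 2 * j) (by omega)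
    have h3 := key i j (by omega)
    simp only [completeBipartiteGraph_adj] at h1
    simp only
    revert h1 h3
    cases (P i).getVert (2 * j) <;> cases (P i).getVert (2 * j + 1) <;> simp
  choose f hf using key'
  have hinj : Function.Injective f := by
    rintro ⟨j, i⟩ ⟨j', i'⟩ h
    have e := hf (j, i)
    have e' := hf (j', i')
    rw [← h] at e'
    simp only at e e'
    obtain rfl : i = i' := by
      by_contra hne
      have := hd i i' hne (.inl (f (j, i))) (e ▸ (P i).getVert_mem_support _)
        (e' ▸ (P i').getVert_mem_support _)
      simp at this
    have hl := (hP i).2.1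
    have := (hP i).1.getVert_injOn (x₁ := 2 * j + 1) (x₂ := 2 * j' + 1)
      (by simp; omega) (by simp; omega) (e.trans e'.symm)
    simp only [Prod.mk.injEq, and_true]
    omega
  simpa using Fintype.card_le_of_injective f hinj

/-! ### Asymptotics -/

theorem isEquivalent_div_of_le {m : ℕ → ℕ} (hm : Tendsto m atTop atTop) {k : ℕ} (hk : 0 < k)
    {f : ℕ → ℝ} {C : ℝ} (hf : ∀ᶠ n in atTop, f n ≤ m n / k)
    (hf' : ∀ᶠ n in atTop, (m n : ℝ) / k - C * (√(m n) + 1) ≤ f n) :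
    f ~[atTop] fun n => (m n : ℝ) / k := by
  have hsqrt : (fun x : ℝ => √x + 1) =o[atTop] fun x : ℝ => x := by
    refine IsLittleO.add ?_ (isLittleO_const_id_atTop 1)
    refine isLittleO_of_tendsto' ?_ ?_
    · filter_upwards [eventually_gt_atTop 0] with x hx h
      exact absurd h hx.ne'
    · have h := tendsto_inv_atTop_zero.comp Real.tendsto_sqrt_atTop
      refine h.congr fun x => ?_
      simp [Real.sqrt_div_self']
  have hmr : Tendsto (fun n => (m n : ℝ)) atTop atTop := tendsto_natCast_atTop_atTop.comp hm
  have hbig : (fun n => f n - (m n : ℝ) / k) =O[atTop] fun n => √(m n) + 1 := by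
    refine IsBigO.of_bound C ?_
    filter_upwards [hf, hf'] with n h h'
    have h0 : 0 ≤ √(m n : ℝ) := Real.sqrt_nonneg _
    rw [Real.norm_eq_abs, Real.norm_eq_abs, abs_of_nonpos (by linarith),
      abs_of_nonneg (by linarith)]
    linarith
  have hlit := hbig.trans_isLittleO (hsqrt.comp_tendsto hmr)
  have hk' : (k : ℝ)⁻¹ ≠ 0 := by positivity
  refine IsLittleO.isEquivalent ?_
  simpa [div_eq_mul_inv, Pi.sub_def, mul_comm _ (k : ℝ)⁻¹] using hlit.const_mul_right hk'

/-- After doubling, the `2k - 2` matchings cost at most `8k(√m + 1)`; the floor and the subtracted 1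
cost at most 4. -/
theorem sub_le_two_mul_sub {k : ℕ} (hk : 2 ≤ k) (m : ℕ) :
    (m : ℝ) / k - (8 * k + 4 : ℝ) * (√m + 1) ≤
      (2 * (m / (2 * k) - 1 - (2 * k - 2) * (2 * (m.sqrt + 1))) : ℕ) := by
  have hk0 : (0 : ℝ) < k := by positivity
  have h1 : (m : ℝ) / (2 * k) ≤ ((m / (2 * k) : ℕ) : ℝ) + 1 := by
    have := Nat.lt_floor_add_one ((m : ℝ) / ((2 * k : ℕ) : ℝ))
    rw [Nat.floor_div_eq_div] at this
    push_cast at this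
    exact this.le
  have h2 : (m / (2 * k) : ℕ) ≤
      (m / (2 * k) - 1 - (2 * k - 2) * (2 * (m.sqrt + 1))) + 1 + 2 * k * (2 * (m.sqrt + 1)) := by
    have : (2 * k - 2) * (2 * (m.sqrt + 1)) ≤ 2 * k * (2 * (m.sqrt + 1)) :=
      Nat.mul_le_mul_right _ (Nat.sub_le _ _)
    omega
  have h3 : ((m / (2 * k) : ℕ) : ℝ) ≤
      ((m / (2 * k) - 1 - (2 * k - 2) * (2 * (m.sqrt + 1)) : ℕ) : ℝ) + 1 +
        2 * k * (2 * (m.sqrt + 1)) := by exact_mod_cast h2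
  have h4 : (m.sqrt : ℝ) ≤ √m := Real.nat_sqrt_le_real_sqrt
  have h5 : (m : ℝ) / k = 2 * (m / (2 * k)) := by field_simp
  have h6 : (k : ℝ) * m.sqrt ≤ k * √m := mul_le_mul_of_nonneg_left h4 hk0.le
  have h7 : 0 ≤ √(m : ℝ) := Real.sqrt_nonneg _
  rw [Nat.cast_mul, h5]
  push_cast at h3 ⊢
  nlinarith

end AltPaths

theorem theorem3p1 (r k : ℕ) (hr : 2 ≤ r) (hk : 2 ≤ k) (m : ℕ → ℕ)
    (hmn : ∀ᶠ n in atTop, m n ≤ n) (hm : Tendsto m atTop atTop) :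
    (fun n => (AltPaths.kappa r (2 * k) (m n) n : ℝ)) ~[atTop] (fun n => (m n : ℝ) / k) ∧
    ∃ t : ℕ → ℕ, (fun n => (t n : ℝ)) ~[atTop] (fun n => (m n : ℝ) / k) ∧
      ∀ᶠ n in atTop, ∃ c : (AltPaths.Kmn (m n) n).EdgeLabeling (Fin r),
        (Set.range c).ncard ≤ 2 ∧ AltPaths.Connects c (2 * k) (t n) := by
  let t : ℕ → ℕ := fun n =>
    2 * (m n / (2 * k) - 1 - (2 * k - 2) * (2 * ((m n).sqrt + 1)))
  have hk0 : (0 : ℝ) < k := by positivity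
  have hcol : ∀ᶠ n in atTop, ∃ c : (AltPaths.Kmn (m n) n).EdgeLabeling (Fin r),
      (Set.range c).ncard ≤ 2 ∧ AltPaths.Connects c (2 * k) (t n) := by
    filter_upwards [hmn, hm.eventually_ge_atTop 1] with n h h'
    exact AltPaths.exists_two_coloring_connects hr hk h' h le_rfl
  have hgreatest : ∀ᶠ n in atTop, IsGreatest
      {t : ℕ | ∃ c : (AltPaths.Kmn (m n) n).EdgeLabeling (Fin r), AltPaths.Connects c (2 * k) t}
      (AltPaths.kappa r (2 * k) (m n) n) := by
    filter_upwards [eventually_ge_atTop 2] with n hn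
    exact AltPaths.isGreatest_kappa (by omega) (by omega) hn
  have hle : ∀ᶠ n in atTop, t n ≤ AltPaths.kappa r (2 * k) (m n) n := by
    filter_upwards [hcol, hgreatest] with n ⟨c, _, hc⟩ hg
    exact hg.2 ⟨c, hc⟩
  have hkappa : ∀ᶠ n in atTop, (AltPaths.kappa r (2 * k) (m n) n : ℝ) ≤ m n / k := by
    filter_upwards [hgreatest, eventually_ge_atTop 2] with n hg hn
    obtain ⟨c, hc⟩ := hg.1
    rw [le_div_iff₀ hk0, mul_comm]
    exact_mod_cast AltPaths.mul_le_of_connects hn c hc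
  have hlow : ∀ n, (m n : ℝ) / k - (8 * k + 4 : ℝ) * (√(m n) + 1) ≤ t n :=
    fun n => AltPaths.sub_le_two_mul_sub hk (m n)
  refine ⟨AltPaths.isEquivalent_div_of_le (C := 8 * k + 4) hm (by omega) hkappa ?_,
    t, AltPaths.isEquivalent_div_of_le hm (by omega) ?_ (.of_forall hlow), hcol⟩
  · filter_upwards [hle] with n hn
    exact (hlow n).trans (by exact_mod_cast hn)
  · filter_upwards [hle, hkappa] with n hn hn'
    exact le_trans (by exact_mod_cast hn) hn'
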